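/- Let $\mathcal G=(V,E)$ be a connected undirected (finite, simple) graph with $n$ nodes and $m$ edges, arbitrarily oriented, with incidence matrix $B\in\mathbb R^{n\times m}$, and let $r\in\mathbb N$. Let each node $i\in V$ carry an inertia matrix $M_i\succ0$ and a damping matrix $R_i\succcurlyeq 0$, and each edge $k\in E$ a weight matrix $W_k\succ0$, all real symmetric $r\times r$ matrices. Put $M=\mathrm{diag}(M_i)$, $R=\mathrm{diag}(R_i)$, $W=\mathrm{diag}(W_k)$, $\mathbb B=B\otimes I_r$, $L=\mathbb B W\mathbb B^T$ and $\mathbb I_r=\mathbf 1\otimes I_r$, where $\mathbf 1\in\mathbb R^n$ is the all-ones vector. Let $v\in\mathbb R^{rn}$ be a constant external input and consider, for $t\ge0$, the closed-loop system $$\dot p=-RM^{-1}p-\mathbb BWq+v,\qquad \dot q=\mathbb B^TM^{-1}p,\qquad y=M^{-1}p .$$ A node $i$ is called damped if $R_i\succ0$ and (partially) undamped if $R_i$ is singular; assume that there is at least one damped and at least one (partially) undamped node. Ordering the damped nodes (index $d$) before the (partially) undamped ones (index $u$), write $$M=\begin{pmatrix}M_d&0\\0&M_u\end{pmatrix},\quad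 R=\begin{pmatrix}R_d&0\\0&R_u\end{pmatrix},\quad L=\begin{pmatrix}L_{dd}&L_i^i\\(L_i^i)^T&L_{uu}\end{pmatrix},$$ and let $\tilde L_u=L_{uu}-(L_i^i)^TL_{dd}^{-1}L_i^i$ be the Kron-reduced Laplacian of the undamped nodes. Then the following are equivalent: (i) for every initial state $(p(0),q(0))$ the output trajectory $y(t)$ converges, as $t\to\infty$, to a point of $\mathrm{im}(\mathbb I_r)$; (ii) no eigenvector of $M_u^{-1}\tilde L_u$ lies in $\ker L_i^i\cap\ker R_u$; (iii) every eigenvector of $M^{-1}L$ that lies in $\ker R$ has at least one nonzero entry at a damped node. Here eigenvectors may be taken to be either real or complex: the equivalence holds in both readings. -/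

import Mathlib

open Filter Topology
open scoped Kronecker

/-- A mass-spring-damper network on the undirected connected graph `G`, with node and edge dynamics
of dimension `r`. Every edge carries an (arbitrary) orientation from `tail` to `head`. Nodes carry
an inertia matrix and a damping matrix, edges carry a weight (spring) matrix. -/
structure MSDNetwork {V : Type*} [Fintype V] (G : SimpleGraph V) (r : ℕ) where
  connected : G.Connected
  tail : G.edgeSet → V
  head : G.edgeSet → V
  mk_tail_head : ∀ k, s(tail k, head k) = (k : Sym2 V)
  /-- inertia matrices `M_i ≻ 0` -/
  inertia : V → Matrix (Fin r) (Fin r) ℝ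
  inertia_posDef : ∀ i, (inertia i).PosDef
  /-- damping matrices `R_i ≽ 0` -/
  damping : V → Matrix (Fin r) (Fin r) ℝ
  damping_posSemidef : ∀ i, (damping i).PosSemidef
  /-- edge weight matrices `W_k ≻ 0` -/
  weight : G.edgeSet → Matrix (Fin r) (Fin r) ℝ
  weight_posDef : ∀ k, (weight k).PosDef

namespace MSDNetwork

variable {V : Type*} [Fintype V] [DecidableEq V] {G : SimpleGraph V} [Fintype G.edgeSet] {r : ℕ}

/-- A node is damped if its damping matrix is positive definite. -/
def IsDamped (N : MSDNetwork G r) (i : V) : Prop := (N.damping i).PosDef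

/-- A node is (partially) undamped if its damping matrix is singular. As damping matrices are
positive semidefinite, this is the case exactly when the node is not damped. -/
def IsUndamped (N : MSDNetwork G r) (i : V) : Prop := (N.damping i).det = 0

noncomputable instance (N : MSDNetwork G r) (i : V) : Decidable (N.IsDamped i) :=
  Classical.propDecidable _

noncomputable instance (N : MSDNetwork G r) (i : V) : Decidable (N.IsUndamped i) :=
  Classical.propDecidable _

/-- The (oriented) incidence matrix `B` of the graph. -/
def incidence (N : MSDNetwork G r) : Matrix V G.edgeSet ℝ :=
  Matrix.of fun i k => if i = N.head k then 1 else if i = N.tail k then -1 else 0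

/-- The matrix `𝔹 = B ⊗ I_r`. -/
def bigB (N : MSDNetwork G r) : Matrix (V × Fin r) (G.edgeSet × Fin r) ℝ :=
  N.incidence ⊗ₖ (1 : Matrix (Fin r) (Fin r) ℝ)

/-- The block diagonal matrix `M = diag(M_1, …, M_n)`. -/
def bigM (N : MSDNetwork G r) : Matrix (V × Fin r) (V × Fin r) ℝ :=
  Matrix.comp V V (Fin r) (Fin r) ℝ (Matrix.diagonal N.inertia)

/-- The block diagonal matrix `R = diag(R_1, …, R_n)`. -/
def bigR (N : MSDNetwork G r) : Matrix (V × Fin r) (V × Fin r) ℝ :=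
  Matrix.comp V V (Fin r) (Fin r) ℝ (Matrix.diagonal N.damping)

/-- The block diagonal matrix `W = diag(W_1, …, W_m)`. -/
def bigW (N : MSDNetwork G r) : Matrix (G.edgeSet × Fin r) (G.edgeSet × Fin r) ℝ :=
  Matrix.comp G.edgeSet G.edgeSet (Fin r) (Fin r) ℝ (Matrix.diagonal N.weight)

/-- The total Laplacian matrix `L = 𝔹 W 𝔹ᵀ`. -/
def lap (N : MSDNetwork G r) : Matrix (V × Fin r) (V × Fin r) ℝ :=
  N.bigB * N.bigW * N.bigB.transpose

/-- The matrix `𝕀_r = 𝟙 ⊗ I_r`: it sends `β` to the stacked vector `(β, …, β)`. -/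
def stackedId (V : Type*) (r : ℕ) : Matrix (V × Fin r) (Fin r) ℝ :=
  Matrix.of fun x b => if x.2 = b then 1 else 0

/-- `(p, q)` is a trajectory on `[0, ∞)` of the closed-loop system with constant external input `v`:
`ṗ = -R M⁻¹ p - 𝔹 W q + v`, `q̇ = 𝔹ᵀ M⁻¹ p`. -/
def IsTrajectory (N : MSDNetwork G r) (v : V × Fin r → ℝ)
    (p : ℝ → V × Fin r → ℝ) (q : ℝ → G.edgeSet × Fin r → ℝ) : Prop :=
  ∀ t : ℝ, 0 ≤ t →
    HasDerivWithinAt p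
      (-((N.bigR * N.bigM⁻¹).mulVec (p t)) - (N.bigB * N.bigW).mulVec (q t) + v) (Set.Ici 0) t ∧
    HasDerivWithinAt q ((N.bigB.transpose * N.bigM⁻¹).mulVec (p t)) (Set.Ici 0) t

/-- The plant output `y = M⁻¹ p`. -/
noncomputable def output (N : MSDNetwork G r) (p : ℝ → V × Fin r → ℝ) : ℝ → V × Fin r → ℝ :=
  fun t => N.bigM⁻¹.mulVec (p t)

/-- The (stacked) indices that belong to damped nodes. -/
abbrev DampedIdx (N : MSDNetwork G r) : Type _ := {x : V × Fin r // N.IsDamped x.1}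

/-- The (stacked) indices that belong to (partially) undamped nodes. -/
abbrev UndampedIdx (N : MSDNetwork G r) : Type _ := {x : V × Fin r // N.IsUndamped x.1}

/-- The block `M_u` of `M`. -/
def Mu (N : MSDNetwork G r) : Matrix N.UndampedIdx N.UndampedIdx ℝ :=
  N.bigM.toBlock (fun x => N.IsUndamped x.1) (fun x => N.IsUndamped x.1)

/-- The block `R_u` of `R`. -/
def Ru (N : MSDNetwork G r) : Matrix N.UndampedIdx N.UndampedIdx ℝ :=
  N.bigR.toBlock (fun x => N.IsUndamped x.1) (fun x => N.IsUndamped x.1)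

/-- The damped diagonal block of `L`, that is `L_d^d + L_d^i`. -/
def lapD (N : MSDNetwork G r) : Matrix N.DampedIdx N.DampedIdx ℝ :=
  N.lap.toBlock (fun x => N.IsDamped x.1) (fun x => N.IsDamped x.1)

/-- The undamped diagonal block of `L`, that is `L_u^u + L_u^i`. -/
def lapU (N : MSDNetwork G r) : Matrix N.UndampedIdx N.UndampedIdx ℝ :=
  N.lap.toBlock (fun x => N.IsUndamped x.1) (fun x => N.IsUndamped x.1)

/-- The block `L_i^i` of `L`, with rows at damped nodes and columns at undamped nodes. -/
def lapI (N : MSDNetwork G r) : Matrix N.DampedIdx N.UndampedIdx ℝ :=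
  N.lap.toBlock (fun x => N.IsDamped x.1) (fun x => N.IsUndamped x.1)

/-- The Kron-reduced Laplacian of the undamped nodes, the Schur complement
`L̃_u = (L_u^u + L_u^i) - (L_i^i)ᵀ (L_d^d + L_d^i)⁻¹ L_i^i`. -/
noncomputable def lapKron (N : MSDNetwork G r) : Matrix N.UndampedIdx N.UndampedIdx ℝ :=
  N.lapU - N.lapI.transpose * N.lapD⁻¹ * N.lapI

/-- Every plant output trajectory (for constant external input `v` and any initial state) converges
to a point of `im 𝕀_r`. -/
def OutputConsensus (N : MSDNetwork G r) (v : V × Fin r → ℝ) : Prop :=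
  ∀ p q, N.IsTrajectory v p q →
    ∃ y₀ ∈ Set.range (stackedId V r).mulVec, Tendsto (N.output p) atTop (𝓝 y₀)

end MSDNetwork

/-- The real matrix `A` has the eigenvector `x` over `𝕜` (`ℝ` or `ℂ`) with eigenvalue `μ`. -/
def Matrix.HasEigenvectorOver (𝕜 : Type*) [RCLike 𝕜] {n : Type*} [Fintype n] [DecidableEq n]
    (A : Matrix n n ℝ) (μ : 𝕜) (x : n → 𝕜) : Prop :=
  Module.End.HasEigenvector (Matrix.toLin' (A.map (algebraMap ℝ 𝕜))) μ x

/-! All three conditions say that there is no undamped mode, meaning a real `x ≠ 0` with `L x = μ M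
x` and `R x = 0` (`HasUndampedMode`). A mode has `μ > 0`, because `𝔹ᵀ x = 0` and `R x = 0` force `x
= 0`. It therefore adds an undying oscillation `cos(√μ t) x` to an equilibrium output. Without
modes, subtract an equilibrium (`exists_equilibrium`) and use the energy `yᵀ M y + qᵀ W q`, whose
derivative is `-2 yᵀ R y`. A Barbalat argument replaces LaSalle's principle: the space `D` of all
`w` with `w ⬝ y → 0` contains the image of `R` and is stable under `L M⁻¹`. Its annihilator is then
an `M⁻¹ L`-invariant subspace of `ker R`. As `M⁻¹ L` is symmetric for the inner product of `M`, a
nonzero such subspace would contain a mode. Hence `D` is everything and `y → 0`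
(`PosDef.tendsto_zero_of_damped_oscillator`). A mode vanishes at damped nodes, so the damped rows of
its equation read `L_i^i x_u = 0`, and the Kron correction drops out
(`hasUndampedMode_iff_lapKron`). Symmetry of the pencils reduces complex eigenvectors to real ones.
-/

/-! ### Limits of scalar functions on the half-line -/

/-- A function on `[0, ∞)` that converges and has a bounded second derivative has a derivative that
tends to zero (a form of Barbalat's lemma). -/
theorem tendsto_deriv_zero_of_tendsto_of_isBigO {f f' f'' : ℝ → ℝ} {c : ℝ}
    (hf : ∀ t ∈ Set.Ici (0 : ℝ), HasDerivWithinAt f (f' t) (Set.Ici 0) t)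
    (hf' : ∀ t ∈ Set.Ici (0 : ℝ), HasDerivWithinAt f' (f'' t) (Set.Ici 0) t)
    (hb : f'' =O[𝓟 (Set.Ici 0)] (fun _ => (1 : ℝ)))
    (hc : Tendsto f atTop (𝓝 c)) : Tendsto f' atTop (𝓝 0) := by
  obtain ⟨K, hK, hb⟩ := hb.exists_pos
  rw [Asymptotics.isBigOWith_principal] at hb
  simp only [norm_one, mul_one] at hb
  -- First-order Taylor estimate at `t` with remainder `K h²`, from the mean value inequality for
  -- `f` minus its tangent.
  have key : ∀ t : ℝ, 0 ≤ t → ∀ h : ℝ, 0 < h → |f' t| * h ≤ |f (t + h) - f t| + K * h * h := by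
    intro t ht h hh
    have hsub : Set.Icc t (t + h) ⊆ Set.Ici (0 : ℝ) := fun s hs => ht.trans hs.1
    have h1 : ∀ s ∈ Set.Icc t (t + h), ‖f' s - f' t‖ ≤ K * h := by
      intro s hs
      refine (Convex.norm_image_sub_le_of_norm_hasDerivWithin_le hf' hb (convex_Ici 0) ht
        (hsub hs)).trans ?_
      gcongr
      rw [Real.norm_of_nonneg (by linarith [hs.1])]
      linarith [hs.2]
    have h2 : ∀ s ∈ Set.Icc t (t + h),
        HasDerivWithinAt (fun s => f s - s * f' t) (f' s - f' t) (Set.Icc t (t + h)) s := by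
      intro s hs
      have := ((hf s (hsub hs)).mono hsub).sub
        ((hasDerivWithinAt_id s (Set.Icc t (t + h))).mul_const (f' t))
      rw [one_mul] at this
      exact this
    have h3 := Convex.norm_image_sub_le_of_norm_hasDerivWithin_le h2 h1 (convex_Icc _ _)
      (Set.left_mem_Icc.2 (by linarith)) (Set.right_mem_Icc.2 (by linarith))
    rw [add_sub_cancel_left, Real.norm_of_nonneg hh.le, Real.norm_eq_abs] at h3
    have h4 : f' t * h = (f (t + h) - f t) - (f (t + h) - (t + h) * f' t - (f t - t * f' t)) := by
      ring
    calc |f' t| * h = |f' t * h| := by rw [abs_mul, abs_of_pos hh]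
      _ ≤ _ := by rw [h4]; exact (abs_sub _ _).trans (by linarith)
  rw [Metric.tendsto_atTop]
  intro ε hε
  -- The remainder then costs `K h = ε / 2`, and the difference quotient of `f` the other half.
  set h : ℝ := ε / (2 * K) with hh
  have hpos : 0 < h := by positivity
  obtain ⟨T, hT⟩ := Metric.tendsto_atTop.1 hc (ε * h / 4) (by positivity)
  refine ⟨max T 0, fun t ht => ?_⟩
  have h1 := key t (le_trans (le_max_right _ _) ht) h hpos
  have h2 := hT t (le_trans (le_max_left _ _) ht)
  have h3 := hT (t + h) (by linarith [le_trans (le_max_left T 0) ht])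
  rw [Real.dist_eq] at h2 h3 ⊢
  rw [sub_zero]
  have h4 : |f (t + h) - f t| < ε * h / 2 := by
    rw [abs_lt] at *
    constructor <;> linarith
  have h5 : K * h = ε / 2 := by rw [hh]; field_simp
  rw [h5] at h1
  nlinarith

/-- A bounded below function on `[0, ∞)` with nonpositive derivative converges. -/
theorem exists_tendsto_of_deriv_nonpos {f f' : ℝ → ℝ}
    (hf : ∀ t ∈ Set.Ici (0 : ℝ), HasDerivWithinAt f (f' t) (Set.Ici 0) t)
    (hf' : ∀ t ∈ Set.Ici (0 : ℝ), f' t ≤ 0) (hb : ∀ t ∈ Set.Ici (0 : ℝ), 0 ≤ f t) :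
    (∀ t ∈ Set.Ici (0 : ℝ), f t ≤ f 0) ∧ ∃ c, Tendsto f atTop (𝓝 c) := by
  have hanti : AntitoneOn f (Set.Ici 0) := by
    have hd : ∀ t ∈ interior (Set.Ici (0 : ℝ)), HasDerivAt f (f' t) t := fun t ht =>
      (hf t (interior_subset ht)).hasDerivAt (mem_interior_iff_mem_nhds.1 ht)
    refine antitoneOn_of_deriv_nonpos (convex_Ici 0) (HasDerivWithinAt.continuousOn hf)
      (fun t ht => (hd t ht).differentiableAt.differentiableWithinAt) fun t ht => ?_
    rw [(hd t ht).deriv]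
    exact hf' t (interior_subset ht)
  refine ⟨fun t ht => hanti Set.self_mem_Ici ht ht, ?_⟩
  -- Freezing `f` at `f 0` on the negative axis makes it antitone on all of `ℝ`, as monotone
  -- convergence requires.
  have hg : Antitone fun t => f (max t 0) := fun s t hst =>
    hanti (le_max_right s 0) (le_max_right t 0) (max_le_max_right 0 hst)
  refine ⟨_, (tendsto_atTop_ciInf hg ⟨0, ?_⟩).congr' ?_⟩
  · rintro _ ⟨t, rfl⟩
    exact hb _ (le_max_right t 0)
  · filter_upwards [eventually_ge_atTop 0] with t ht
    rw [max_eq_left ht]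

/-! ### Quadratic forms and calculus along vector-valued curves -/

namespace Matrix

variable {n m : Type*} [Fintype n] [Fintype m]

theorem IsHermitian.dotProduct_mulVec_comm {A : Matrix n n ℝ} (hA : A.IsHermitian) (x y : n → ℝ) :
    x ⬝ᵥ A *ᵥ y = y ⬝ᵥ A *ᵥ x := by
  have h : A.transpose = A := by rw [← conjTranspose_eq_transpose_of_trivial]; exact hA
  rw [dotProduct_mulVec, dotProduct_comm, ← mulVec_transpose, h]

/-- The Cauchy-Schwarz inequality for a positive semidefinite matrix. -/
theorem PosSemidef.dotProduct_mulVec_sq_le {A : Matrix n n ℝ} (hA : A.PosSemidef) (x y : n → ℝ) :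
    (x ⬝ᵥ A *ᵥ y) ^ 2 ≤ (x ⬝ᵥ A *ᵥ x) * (y ⬝ᵥ A *ᵥ y) := by
  have h : ∀ t : ℝ, 0 ≤ (x ⬝ᵥ A *ᵥ x) * (t * t) + (2 * (x ⬝ᵥ A *ᵥ y)) * t + y ⬝ᵥ A *ᵥ y := by
    intro t
    have := hA.dotProduct_mulVec_nonneg (t • x + y)
    rw [star_trivial, mulVec_add, mulVec_smul, add_dotProduct, dotProduct_add, dotProduct_add,
      smul_dotProduct, smul_dotProduct, dotProduct_smul, dotProduct_smul,
      hA.isHermitian.dotProduct_mulVec_comm y x] at this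
    simp only [smul_eq_mul] at this
    linarith
  have := discrim_le_zero h
  rw [discrim] at this
  linarith

/-- Cauchy-Schwarz for the pair `A x`, `x` bounds the square of `A x ⬝ A x` by zero. -/
theorem PosSemidef.mulVec_eq_zero_of_dotProduct {A : Matrix n n ℝ} (hA : A.PosSemidef) {x : n → ℝ}
    (h : x ⬝ᵥ A *ᵥ x = 0) : A *ᵥ x = 0 := by
  have := hA.dotProduct_mulVec_sq_le (A *ᵥ x) x
  rw [h, mul_zero] at this
  exact dotProduct_self_eq_zero.1 (pow_eq_zero_iff two_ne_zero |>.1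
    (le_antisymm this (sq_nonneg _)))

theorem PosDef.eq_zero_of_mulVec_eq_zero {A : Matrix n n ℝ} (hA : A.PosDef) {x : n → ℝ}
    (h : A *ᵥ x = 0) : x = 0 := by
  by_contra hx
  have := hA.dotProduct_mulVec_pos hx
  simp [h] at this

theorem PosDef.mulVec_inv_mulVec [DecidableEq n] {A : Matrix n n ℝ} (hA : A.PosDef) (x : n → ℝ) :
    A *ᵥ A⁻¹ *ᵥ x = x := by
  rw [mulVec_mulVec, mul_nonsing_inv _ ((isUnit_iff_isUnit_det A).1 hA.isUnit), one_mulVec]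

theorem PosDef.inv_mulVec_mulVec [DecidableEq n] {A : Matrix n n ℝ} (hA : A.PosDef) (x : n → ℝ) :
    A⁻¹ *ᵥ A *ᵥ x = x := by
  rw [mulVec_mulVec, nonsing_inv_mul _ ((isUnit_iff_isUnit_det A).1 hA.isUnit), one_mulVec]

theorem mulVec_hasDerivWithinAt (A : Matrix m n ℝ) {f : ℝ → n → ℝ} {f' : n → ℝ} {s : Set ℝ} {t : ℝ}
    (hf : HasDerivWithinAt f f' s t) :
    HasDerivWithinAt (fun t => A *ᵥ f t) (A *ᵥ f') s t :=
  A.mulVecLin.toContinuousLinearMap.hasFDerivAt.comp_hasDerivWithinAt t hf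

theorem dotProduct_hasDerivWithinAt {f g : ℝ → n → ℝ} {f' g' : n → ℝ} {s : Set ℝ} {t : ℝ}
    (hf : HasDerivWithinAt f f' s t) (hg : HasDerivWithinAt g g' s t) :
    HasDerivWithinAt (fun t => f t ⬝ᵥ g t) (f' ⬝ᵥ g t + f t ⬝ᵥ g') s t := by
  simp only [dotProduct, ← Finset.sum_add_distrib]
  refine HasDerivWithinAt.fun_sum fun i _ => ?_
  exact (hasDerivWithinAt_pi.1 hf i).mul (hasDerivWithinAt_pi.1 hg i)

theorem dotProduct_mulVec_self_hasDerivWithinAt {A : Matrix n n ℝ} (hA : A.IsHermitian)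
    {f : ℝ → n → ℝ} {f' : n → ℝ} {s : Set ℝ} {t : ℝ} (hf : HasDerivWithinAt f f' s t) :
    HasDerivWithinAt (fun t => f t ⬝ᵥ A *ᵥ f t) (2 * (f t ⬝ᵥ A *ᵥ f')) s t := by
  convert dotProduct_hasDerivWithinAt hf (A.mulVec_hasDerivWithinAt hf) using 1
  rw [hA.dotProduct_mulVec_comm f']
  ring

theorem mulVec_isBigO_one (A : Matrix m n ℝ) {f : ℝ → n → ℝ} {l : Filter ℝ}
    (hf : f =O[l] (fun _ => (1 : ℝ))) : (fun t => A *ᵥ f t) =O[l] (fun _ => (1 : ℝ)) :=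
  (A.mulVecLin.toContinuousLinearMap.isBigO_comp f l).trans hf

theorem dotProduct_isBigO_one {f g : ℝ → n → ℝ} {l : Filter ℝ}
    (hf : f =O[l] (fun _ => (1 : ℝ))) (hg : g =O[l] (fun _ => (1 : ℝ))) :
    (fun t => f t ⬝ᵥ g t) =O[l] (fun _ => (1 : ℝ)) := by
  refine Asymptotics.IsBigO.fun_sum (A := fun i t => f t i * g t i) fun i _ => ?_
  simpa using (Asymptotics.isBigO_pi.1 hf i).mul (Asymptotics.isBigO_pi.1 hg i)

theorem PosDef.isBigO_one_of_dotProduct_mulVec_le [DecidableEq n] {A : Matrix n n ℝ}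
    (hA : A.PosDef) {f : ℝ → n → ℝ} {s : Set ℝ} {c : ℝ} (hf : ∀ t ∈ s, f t ⬝ᵥ A *ᵥ f t ≤ c) :
    f =O[𝓟 s] (fun _ => (1 : ℝ)) := by
  rw [Asymptotics.isBigO_pi]
  intro i
  -- With this `w` the coordinate `f t i` equals `f t ⬝ A w`, which Cauchy-Schwarz bounds by the
  -- energy.
  set w : n → ℝ := A⁻¹ *ᵥ Pi.single i 1
  refine Asymptotics.IsBigO.of_bound (√((w ⬝ᵥ A *ᵥ w) * c)) ?_
  rw [eventually_principal]
  intro t ht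
  have h := hA.posSemidef.dotProduct_mulVec_sq_le (f t) w
  rw [hA.mulVec_inv_mulVec, dotProduct_single_one] at h
  rw [norm_one, mul_one, Real.norm_eq_abs]
  apply Real.abs_le_sqrt
  refine h.trans ?_
  have hw := hA.posSemidef.dotProduct_mulVec_nonneg w
  rw [star_trivial] at hw
  rw [hA.mulVec_inv_mulVec] at hw ⊢
  rw [mul_comm]
  exact mul_le_mul_of_nonneg_left (hf t ht) hw

/-- An endomorphism of a nontrivial finite-dimensional real space that is symmetric for some inner
product has an eigenvector. -/
theorem _root_.exists_eigenvector_of_symmetric_bilin {E : Type*} [AddCommGroup E] [Module ℝ E]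
    [FiniteDimensional ℝ E] [Nontrivial E] (b : LinearMap.BilinForm ℝ E)
    (hb : ∀ x y, b x y = b y x) (hpos : ∀ x, x ≠ 0 → 0 < b x x) (T : E →ₗ[ℝ] E)
    (hT : ∀ x y, b (T x) y = b x (T y)) : ∃ (μ : ℝ) (x : E), x ≠ 0 ∧ T x = μ • x := by
  let core : InnerProductSpace.Core ℝ E :=
    { inner := fun x y => b x y
      conj_inner_symm := fun x y => by simpa using hb y x
      re_inner_nonneg := fun x => by
        rcases eq_or_ne x 0 with rfl | hx
        · simp
        · exact (hpos x hx).le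
      add_left := fun x y z => by simp
      smul_left := fun x y r => by simp
      definite := fun x hx => by
        by_contra h
        exact (hpos x h).ne' hx }
  let _ : NormedAddCommGroup E := core.toNormedAddCommGroup
  let _ : InnerProductSpace ℝ E := InnerProductSpace.ofCore core.toCore
  have hS : T.IsSymmetric := fun x y => hT x y
  obtain ⟨x, hx⟩ := hS.hasEigenvalue_iSup_of_finiteDimensional.exists_hasEigenvector
  exact ⟨_, x, hx.2, hx.apply_eq_smul⟩

/-- If the symmetric pencil `L x = μ M x` has no eigenvector in `ker R`, then every subspace of
`ker R` that is invariant under `M⁻¹ L` is trivial. -/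
theorem PosDef.submodule_eq_bot_of_no_eigenvector [DecidableEq n] {M L R : Matrix n n ℝ}
    (hM : M.PosDef) (hL : L.IsHermitian)
    (h : ∀ (μ : ℝ) (x : n → ℝ), L *ᵥ x = μ • M *ᵥ x → R *ᵥ x = 0 → x = 0)
    (U : Submodule ℝ (n → ℝ)) (hU : ∀ x ∈ U, M⁻¹ *ᵥ L *ᵥ x ∈ U) (hR : ∀ x ∈ U, R *ᵥ x = 0) :
    U = ⊥ := by
  by_contra hne
  have : Nontrivial U := Submodule.nontrivial_iff_ne_bot.2 hne
  -- `T` is symmetric for the form of `M`, since `M T = L` on `U`.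
  let T : U →ₗ[ℝ] U := (M⁻¹.mulVecLin ∘ₗ L.mulVecLin).restrict hU
  let b : LinearMap.BilinForm ℝ U := LinearMap.mk₂ ℝ (fun x y => (x : n → ℝ) ⬝ᵥ M *ᵥ (y : n → ℝ))
    (fun _ _ _ => by simp [add_dotProduct]) (fun _ _ _ => by simp)
    (fun _ _ _ => by simp [mulVec_add, dotProduct_add]) (fun _ _ _ => by simp [mulVec_smul])
  have hTapp : ∀ x : U, M *ᵥ (T x : n → ℝ) = L *ᵥ (x : n → ℝ) := fun x =>
    hM.mulVec_inv_mulVec _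
  obtain ⟨μ, x, hx, hTx⟩ := exists_eigenvector_of_symmetric_bilin b
    (fun x y => hM.isHermitian.dotProduct_mulVec_comm _ _)
    (fun x hx => by
      have := hM.dotProduct_mulVec_pos (x := (x : n → ℝ)) (by simpa using hx)
      rwa [star_trivial] at this) T
    (fun x y => by
      change (T x : n → ℝ) ⬝ᵥ M *ᵥ (y : n → ℝ) = (x : n → ℝ) ⬝ᵥ M *ᵥ (T y : n → ℝ)
      rw [hTapp, hM.isHermitian.dotProduct_mulVec_comm, hTapp, hL.dotProduct_mulVec_comm])
  apply hx
  refine Subtype.ext (h μ x ?_ (hR x x.2))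
  rw [← hTapp, hTx, Submodule.coe_smul, mulVec_smul]

end Matrix

/-! ### Convergence of the damped oscillator -/

namespace Matrix

variable {n m : Type*} [Fintype n]

/-- Consider the damped oscillator `M ẏ = -R y - B W q`, `q̇ = Bᵀ y`. If no eigenvector of the pencil
`(B W Bᵀ, M)` lies in `ker R`, then `y` tends to zero along every trajectory. -/
theorem PosDef.tendsto_zero_of_damped_oscillator [Fintype m] [DecidableEq n] [DecidableEq m]
    {M R : Matrix n n ℝ} {W : Matrix m m ℝ}
    (B : Matrix n m ℝ) (hM : M.PosDef) (hR : R.PosSemidef) (hW : W.PosDef)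
    (h : ∀ (μ : ℝ) (x : n → ℝ), (B * W * B.transpose) *ᵥ x = μ • M *ᵥ x → R *ᵥ x = 0 → x = 0)
    {y : ℝ → n → ℝ} {q : ℝ → m → ℝ}
    (hy : ∀ t ∈ Set.Ici (0 : ℝ),
      HasDerivWithinAt y (M⁻¹ *ᵥ (-(R *ᵥ y t) - (B * W) *ᵥ q t)) (Set.Ici 0) t)
    (hq : ∀ t ∈ Set.Ici (0 : ℝ), HasDerivWithinAt q (B.transpose *ᵥ y t) (Set.Ici 0) t) :
    Tendsto y atTop (𝓝 0) := by
  set L := B * W * B.transpose with hLdef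
  have hL : L.IsHermitian := by
    have := hW.posSemidef.mul_mul_conjTranspose_same B
    rw [conjTranspose_eq_transpose_of_trivial] at this
    exact this.isHermitian
  -- the first three derivatives of `y`
  set y₁ : ℝ → n → ℝ := fun t => M⁻¹ *ᵥ (-(R *ᵥ y t) - (B * W) *ᵥ q t) with hy₁
  set y₂ : ℝ → n → ℝ := fun t => M⁻¹ *ᵥ (-(R *ᵥ y₁ t) - L *ᵥ y t) with hy₂
  set y₃ : ℝ → n → ℝ := fun t => M⁻¹ *ᵥ (-(R *ᵥ y₂ t) - L *ᵥ y₁ t) with hy₃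
  have hd₁ : ∀ t ∈ Set.Ici (0 : ℝ), HasDerivWithinAt y₁ (y₂ t) (Set.Ici 0) t := by
    intro t ht
    have h2 := mulVec_hasDerivWithinAt (B * W) (hq t ht)
    rw [mulVec_mulVec] at h2
    exact mulVec_hasDerivWithinAt M⁻¹ ((mulVec_hasDerivWithinAt R (hy t ht)).fun_neg.fun_sub h2)
  have hd₂ : ∀ t ∈ Set.Ici (0 : ℝ), HasDerivWithinAt y₂ (y₃ t) (Set.Ici 0) t := fun t ht =>
    mulVec_hasDerivWithinAt M⁻¹ ((mulVec_hasDerivWithinAt R (hd₁ t ht)).fun_neg.fun_sub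
      (mulVec_hasDerivWithinAt L (hy t ht)))
  -- the energy
  set H : ℝ → ℝ := fun t => (y t ⬝ᵥ M *ᵥ y t) + (q t ⬝ᵥ W *ᵥ q t) with hH
  have hMy : ∀ t, 0 ≤ y t ⬝ᵥ M *ᵥ y t := fun t => by
    simpa using hM.posSemidef.dotProduct_mulVec_nonneg (y t)
  have hWq : ∀ t, 0 ≤ q t ⬝ᵥ W *ᵥ q t := fun t => by
    simpa using hW.posSemidef.dotProduct_mulVec_nonneg (q t)
  have hRy : ∀ t, 0 ≤ y t ⬝ᵥ R *ᵥ y t := fun t => by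
    simpa using hR.dotProduct_mulVec_nonneg (y t)
  have hdH : ∀ t ∈ Set.Ici (0 : ℝ),
      HasDerivWithinAt H (-2 * (y t ⬝ᵥ R *ᵥ y t)) (Set.Ici 0) t := by
    intro t ht
    refine ((dotProduct_mulVec_self_hasDerivWithinAt hM.isHermitian (hy t ht)).fun_add
      (dotProduct_mulVec_self_hasDerivWithinAt hW.isHermitian (hq t ht))).congr_deriv ?_
    -- The exchange terms `y ⬝ B W q` of the two energies cancel, leaving only dissipation.
    rw [hM.mulVec_inv_mulVec, dotProduct_sub, dotProduct_neg,
      hW.isHermitian.dotProduct_mulVec_comm (q t), ← mulVec_mulVec, mulVec_transpose,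
      dotProduct_mulVec (y t) B]
    ring
  have hddH : ∀ t ∈ Set.Ici (0 : ℝ), HasDerivWithinAt (fun t => -2 * (y t ⬝ᵥ R *ᵥ y t))
      (-2 * (2 * (y t ⬝ᵥ R *ᵥ y₁ t))) (Set.Ici 0) t := fun t ht =>
    (dotProduct_mulVec_self_hasDerivWithinAt hR.isHermitian (hy t ht)).const_mul _
  obtain ⟨hHle, c, hHc⟩ := exists_tendsto_of_deriv_nonpos hdH
    (fun t _ => by linarith [hRy t]) (fun t _ => add_nonneg (hMy t) (hWq t))
  have by₀ : y =O[𝓟 (Set.Ici 0)] (fun _ => (1 : ℝ)) :=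
    hM.isBigO_one_of_dotProduct_mulVec_le (c := H 0) fun t ht => by linarith [hHle t ht, hWq t]
  have bq : q =O[𝓟 (Set.Ici 0)] (fun _ => (1 : ℝ)) :=
    hW.isBigO_one_of_dotProduct_mulVec_le (c := H 0) fun t ht => by linarith [hHle t ht, hMy t]
  have by₁ : y₁ =O[𝓟 (Set.Ici 0)] (fun _ => (1 : ℝ)) :=
    mulVec_isBigO_one _ ((mulVec_isBigO_one _ by₀).neg_left.sub (mulVec_isBigO_one _ bq))
  have by₂ : y₂ =O[𝓟 (Set.Ici 0)] (fun _ => (1 : ℝ)) :=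
    mulVec_isBigO_one _ ((mulVec_isBigO_one _ by₁).neg_left.sub (mulVec_isBigO_one _ by₀))
  have by₃ : y₃ =O[𝓟 (Set.Ici 0)] (fun _ => (1 : ℝ)) :=
    mulVec_isBigO_one _ ((mulVec_isBigO_one _ by₂).neg_left.sub (mulVec_isBigO_one _ by₁))
  -- the functionals that vanish asymptotically along `y`
  let D : Submodule ℝ (n → ℝ) :=
    { carrier := {w | Tendsto (fun t => w ⬝ᵥ y t) atTop (𝓝 0)}
      zero_mem' := by simp
      add_mem' := fun {a b} ha hb => by
        have := Tendsto.add ha hb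
        simpa only [Set.mem_ofPred_eq, add_dotProduct, add_zero] using this
      smul_mem' := fun a b hb => by
        have := Tendsto.const_mul a hb
        simpa only [Set.mem_ofPred_eq, smul_dotProduct, smul_eq_mul, mul_zero] using this }
  have hDdef : ∀ w, w ∈ D ↔ Tendsto (fun t => w ⬝ᵥ y t) atTop (𝓝 0) := fun _ => Iff.rfl
  have dot : ∀ (w : n → ℝ) {f : ℝ → n → ℝ} {f' : n → ℝ} {t : ℝ},
      HasDerivWithinAt f f' (Set.Ici 0) t →
      HasDerivWithinAt (fun t => w ⬝ᵥ f t) (w ⬝ᵥ f') (Set.Ici 0) t := fun w f f' t hf => by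
    simpa using dotProduct_hasDerivWithinAt (hasDerivWithinAt_const t (Set.Ici 0) w) hf
  have bdot : ∀ (w : n → ℝ) {f : ℝ → n → ℝ}, f =O[𝓟 (Set.Ici 0)] (fun _ => (1 : ℝ)) →
      (fun t => w ⬝ᵥ f t) =O[𝓟 (Set.Ici 0)] (fun _ => (1 : ℝ)) := fun w f hf =>
    dotProduct_isBigO_one (Asymptotics.isBigO_const_const w one_ne_zero _) hf
  have hD₁ : ∀ w ∈ D, Tendsto (fun t => w ⬝ᵥ y₁ t) atTop (𝓝 0) := fun w hw =>
    tendsto_deriv_zero_of_tendsto_of_isBigO (fun t ht => dot w (hy t ht))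
      (fun t ht => dot w (hd₁ t ht)) (bdot w by₂) hw
  -- A second use of Barbalat's lemma; this is where the bound on `y₃` enters.
  have hD₂ : ∀ w ∈ D, Tendsto (fun t => w ⬝ᵥ y₂ t) atTop (𝓝 0) := fun w hw =>
    tendsto_deriv_zero_of_tendsto_of_isBigO (fun t ht => dot w (hd₁ t ht))
      (fun t ht => dot w (hd₂ t ht)) (bdot w by₃) (hD₁ w hw)
  -- Barbalat's lemma for the energy gives `y ⬝ R y → 0`, and Cauchy-Schwarz for `R` passes this on
  -- to `w ⬝ R y`.
  have hDR : ∀ w, R *ᵥ w ∈ D := by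
    intro w
    have h1 : Tendsto (fun t => y t ⬝ᵥ R *ᵥ y t) atTop (𝓝 0) := by
      have := (tendsto_deriv_zero_of_tendsto_of_isBigO hdH hddH
        (((dotProduct_isBigO_one by₀ (mulVec_isBigO_one R by₁)).const_mul_left 2).const_mul_left
          (-2)) hHc).const_mul (-2)⁻¹
      simpa using this
    have h2 : Tendsto (fun t => √((w ⬝ᵥ R *ᵥ w) * (y t ⬝ᵥ R *ᵥ y t))) atTop (𝓝 0) := by
      simpa using (h1.const_mul (w ⬝ᵥ R *ᵥ w)).sqrt
    refine squeeze_zero_norm (fun t => ?_) h2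
    rw [Real.norm_eq_abs, dotProduct_comm, hR.isHermitian.dotProduct_mulVec_comm]
    exact Real.abs_le_sqrt (hR.dotProduct_mulVec_sq_le w (y t))
  have hMi : M⁻¹.IsHermitian := hM.inv.isHermitian
  -- Pair `M y₂ = -R y₁ - L y` with `M⁻¹ w`: the terms in `y₂` and `y₁` tend to zero, hence so does
  -- the one in `y`.
  have hDL : ∀ w ∈ D, L *ᵥ M⁻¹ *ᵥ w ∈ D := by
    intro w hw
    have h1 := (hD₂ w hw).neg.sub (hD₁ _ (hDR (M⁻¹ *ᵥ w)))
    rw [neg_zero, sub_zero] at h1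
    rw [hDdef]
    refine h1.congr fun t => ?_
    rw [hy₂]
    dsimp only
    rw [hMi.dotProduct_mulVec_comm, sub_dotProduct, neg_dotProduct, dotProduct_comm (R *ᵥ y₁ t),
      dotProduct_comm (L *ᵥ y t), hR.isHermitian.dotProduct_mulVec_comm,
      hL.dotProduct_mulVec_comm, dotProduct_comm (y₁ t), dotProduct_comm (y t)]
    ring
  -- The annihilator of `D`. Stability of `D` under `L M⁻¹` dualizes to invariance under `M⁻¹ L`,
  -- and `im R ⊆ D` to `U ⊆ ker R`.
  let U : Submodule ℝ (n → ℝ) :=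
    { carrier := {x | ∀ w ∈ D, w ⬝ᵥ x = 0}
      zero_mem' := by simp
      add_mem' := fun {a b} ha hb w hw => by rw [dotProduct_add, ha w hw, hb w hw, add_zero]
      smul_mem' := fun a b hb w hw => by rw [dotProduct_smul, hb w hw, smul_zero] }
  have hU : U = ⊥ := by
    refine hM.submodule_eq_bot_of_no_eigenvector hL h U (fun x hx w hw => ?_) fun x hx => ?_
    · have := hx _ (hDL w hw)
      rwa [hMi.dotProduct_mulVec_comm, dotProduct_comm, hL.dotProduct_mulVec_comm,
        dotProduct_comm]
    · ext i
      have := hx _ (hDR (Pi.single i 1))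
      rwa [dotProduct_comm, hR.isHermitian.dotProduct_mulVec_comm, single_one_dotProduct] at this
  have hDtop : D = ⊤ := by
    by_contra hne
    obtain ⟨f, hf, hle⟩ := Submodule.exists_le_ker_of_lt_top D (lt_top_iff_ne_top.2 hne)
    have hfw : ∀ w, w ⬝ᵥ (fun i => f (Pi.single i 1)) = f w := fun w => by
      conv_rhs => rw [pi_eq_sum_univ' w]
      simp [dotProduct, map_sum]
    have hx : (fun i => f (Pi.single i 1)) ∈ U := fun w hw => by
      rw [hfw]
      exact hle hw
    rw [hU, Submodule.mem_bot] at hx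
    refine hf (LinearMap.ext fun w => ?_)
    rw [← hfw, hx, dotProduct_zero, LinearMap.zero_apply]
  rw [tendsto_pi_nhds]
  intro i
  have : Pi.single i 1 ∈ D := hDtop ▸ Submodule.mem_top
  simpa [hDdef] using this

/-- An eigenvalue of the pencil `(B W Bᵀ, M)` with eigenvector outside `ker Bᵀ` is positive. -/
theorem PosDef.pos_of_pencil_eigenvector [Fintype m] {M : Matrix n n ℝ} {W : Matrix m m ℝ}
    (B : Matrix n m ℝ) (hM : M.PosDef) (hW : W.PosDef) {μ : ℝ} {x : n → ℝ}
    (h : (B * W * B.transpose) *ᵥ x = μ • M *ᵥ x) (hx : B.transpose *ᵥ x ≠ 0) : 0 < μ := by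
  have hx0 : x ≠ 0 := by rintro rfl; simp at hx
  have h1 := hM.dotProduct_mulVec_pos hx0
  have h2 := hW.dotProduct_mulVec_pos hx
  rw [star_trivial] at h1 h2
  have h3 : x ⬝ᵥ (B * W * B.transpose) *ᵥ x = B.transpose *ᵥ x ⬝ᵥ W *ᵥ B.transpose *ᵥ x := by
    rw [← mulVec_mulVec, ← mulVec_mulVec, dotProduct_mulVec x B, ← mulVec_transpose]
  rw [← h3, h, dotProduct_smul, smul_eq_mul] at h2
  exact (pos_iff_pos_of_mul_pos h2).2 h1

/-! ### Real versus complex eigenvectors -/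

section EigenvectorOver

variable {𝕜 : Type*} [RCLike 𝕜]

theorem re_map_mulVec (A : Matrix m n ℝ) (x : n → 𝕜) (i : m) :
    RCLike.re ((A.map (algebraMap ℝ 𝕜) *ᵥ x) i) = (A *ᵥ fun j => RCLike.re (x j)) i := by
  simp [mulVec, dotProduct, map_sum, RCLike.algebraMap_eq_ofReal]

theorem im_map_mulVec (A : Matrix m n ℝ) (x : n → 𝕜) (i : m) :
    RCLike.im ((A.map (algebraMap ℝ 𝕜) *ᵥ x) i) = (A *ᵥ fun j => RCLike.im (x j)) i := by
  simp [mulVec, dotProduct, map_sum, RCLike.algebraMap_eq_ofReal]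

theorem map_mulVec_ofReal (A : Matrix m n ℝ) (x : n → ℝ) :
    A.map (algebraMap ℝ 𝕜) *ᵥ (fun i => algebraMap ℝ 𝕜 (x i)) =
      fun i => algebraMap ℝ 𝕜 ((A *ᵥ x) i) :=
  funext fun i => ((algebraMap ℝ 𝕜).map_mulVec A x i).symm

theorem hasEigenvectorOver_iff [DecidableEq n] {A : Matrix n n ℝ} {μ : 𝕜} {x : n → 𝕜} :
    A.HasEigenvectorOver 𝕜 μ x ↔ A.map (algebraMap ℝ 𝕜) *ᵥ x = μ • x ∧ x ≠ 0 := by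
  rw [HasEigenvectorOver, Module.End.hasEigenvector_iff, Module.End.mem_eigenspace_iff,
    toLin'_apply]

/-- A real or complex eigenvector of `M⁻¹ L`, with `M` positive definite and `L` symmetric, gives rise
to a real one in the same real kernels. -/
theorem PosDef.exists_real_eigenvector [DecidableEq n] {M L : Matrix n n ℝ} (hM : M.PosDef) (hL : L.IsHermitian)
    {μ : 𝕜} {x : n → 𝕜} (h : (M⁻¹ * L).HasEigenvectorOver 𝕜 μ x) :
    ∃ (ν : ℝ) (z : n → ℝ), z ≠ 0 ∧ L *ᵥ z = ν • M *ᵥ z ∧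
      ∀ {k : Type _} (K : Matrix k n ℝ),
        K.map (algebraMap ℝ 𝕜) *ᵥ x = 0 → K *ᵥ z = 0 := by
  obtain ⟨hx, hx0⟩ := hasEigenvectorOver_iff.1 h
  set a : n → ℝ := fun i => RCLike.re (x i) with ha
  set b : n → ℝ := fun i => RCLike.im (x i) with hb
  have hA : ∀ z w : n → ℝ, (M⁻¹ * L) *ᵥ z = w → L *ᵥ z = M *ᵥ w := fun z w hzw => by
    rw [← hzw, ← mulVec_mulVec, hM.mulVec_inv_mulVec]
  have hLa : L *ᵥ a = M *ᵥ (RCLike.re μ • a - RCLike.im μ • b) := hA _ _ <| funext fun i => by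
    rw [ha, ← re_map_mulVec, hx]
    simp [hb]
  have hLb : L *ᵥ b = M *ᵥ (RCLike.im μ • a + RCLike.re μ • b) := hA _ _ <| funext fun i => by
    rw [hb, ← im_map_mulVec, hx]
    simp [ha]
    ring
  -- Symmetry of `L` on the pair `a`, `b` forces the eigenvalue to be real.
  have hsum : RCLike.im μ * (a ⬝ᵥ M *ᵥ a + b ⬝ᵥ M *ᵥ b) = 0 := by
    have := hL.dotProduct_mulVec_comm a b
    rw [hLa, hLb, mulVec_add, mulVec_sub, dotProduct_add, dotProduct_sub] at this
    simp only [mulVec_smul, dotProduct_smul, smul_eq_mul] at this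
    rw [hM.isHermitian.dotProduct_mulVec_comm b a] at this
    linarith
  have hMa : 0 ≤ a ⬝ᵥ M *ᵥ a := by simpa using hM.posSemidef.dotProduct_mulVec_nonneg a
  have hMb : 0 ≤ b ⬝ᵥ M *ᵥ b := by simpa using hM.posSemidef.dotProduct_mulVec_nonneg b
  -- The same `z` has to serve every real `K`, because the Kron condition involves two kernels at
  -- once.
  have hKa : ∀ {k : Type _} (K : Matrix k n ℝ),
      K.map (algebraMap ℝ 𝕜) *ᵥ x = 0 → K *ᵥ a = 0 := fun K hK => funext fun i => by
    rw [ha, ← re_map_mulVec, hK]; simp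
  have hKb : ∀ {k : Type _} (K : Matrix k n ℝ),
      K.map (algebraMap ℝ 𝕜) *ᵥ x = 0 → K *ᵥ b = 0 := fun K hK => funext fun i => by
    rw [hb, ← im_map_mulVec, hK]; simp
  by_cases ha0 : a = 0
  · have hb0 : b ≠ 0 := fun hb0 => hx0 <| funext fun i =>
      RCLike.ext (by simpa using congrFun ha0 i) (by simpa using congrFun hb0 i)
    refine ⟨RCLike.re μ, b, hb0, ?_, hKb⟩
    rw [hLb, ha0, smul_zero, zero_add, mulVec_smul]
  · have := hM.dotProduct_mulVec_pos ha0
    rw [star_trivial] at this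
    have him : RCLike.im μ = 0 := (mul_eq_zero.1 hsum).resolve_right (by positivity)
    refine ⟨RCLike.re μ, a, ha0, ?_, hKa⟩
    rw [hLa, him, zero_smul, sub_zero, mulVec_smul]

theorem PosDef.hasEigenvectorOver_ofReal [DecidableEq n] {M L : Matrix n n ℝ} (hM : M.PosDef)
    {ν : ℝ} {z : n → ℝ} (hz : z ≠ 0) (h : L *ᵥ z = ν • M *ᵥ z) :
    (M⁻¹ * L).HasEigenvectorOver 𝕜 (algebraMap ℝ 𝕜 ν) (fun i => algebraMap ℝ 𝕜 (z i)) := by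
  rw [hasEigenvectorOver_iff]
  constructor
  · rw [map_mulVec_ofReal, ← mulVec_mulVec, h, mulVec_smul, hM.inv_mulVec_mulVec]
    ext i
    simp
  · contrapose! hz
    ext i
    simpa using congrFun hz i

end EigenvectorOver

end Matrix

/-! ### Block diagonal matrices and restriction to blocks -/

namespace Matrix

variable {ι k : Type*} [Fintype ι] [DecidableEq ι] [Fintype k]

theorem comp_diagonal_mulVec (D : ι → Matrix k k ℝ) (x : ι × k → ℝ) (z : ι × k) :
    (comp ι ι k k ℝ (diagonal D) *ᵥ x) z = (D z.1 *ᵥ fun b => x (z.1, b)) z.2 := by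
  simp only [mulVec, dotProduct, Fintype.sum_prod_type, comp_apply]
  rw [Finset.sum_eq_single z.1]
  · simp
  · intro j _ hj
    simp [diagonal_apply_ne' D hj]
  · simp

theorem isHermitian_comp_diagonal {D : ι → Matrix k k ℝ} (hD : ∀ i, (D i).IsHermitian) :
    (comp ι ι k k ℝ (diagonal D)).IsHermitian := by
  ext ⟨i, a⟩ ⟨j, b⟩
  rcases eq_or_ne i j with rfl | hij
  · simpa using (hD i).apply a b
  · simp [diagonal_apply_ne D hij, diagonal_apply_ne' D hij]

theorem dotProduct_comp_diagonal_mulVec (D : ι → Matrix k k ℝ) (x : ι × k → ℝ) :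
    x ⬝ᵥ comp ι ι k k ℝ (diagonal D) *ᵥ x =
      ∑ i, (fun a => x (i, a)) ⬝ᵥ D i *ᵥ fun a => x (i, a) := by
  simp only [dotProduct, comp_diagonal_mulVec, Fintype.sum_prod_type]

theorem posSemidef_comp_diagonal {D : ι → Matrix k k ℝ} (hD : ∀ i, (D i).PosSemidef) :
    (comp ι ι k k ℝ (diagonal D)).PosSemidef := by
  refine .of_dotProduct_mulVec_nonneg (isHermitian_comp_diagonal fun i => (hD i).isHermitian)
    fun x => ?_
  rw [star_trivial, dotProduct_comp_diagonal_mulVec]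
  exact Finset.sum_nonneg fun i _ => (hD i).dotProduct_mulVec_nonneg _

theorem posDef_comp_diagonal {D : ι → Matrix k k ℝ} (hD : ∀ i, (D i).PosDef) :
    (comp ι ι k k ℝ (diagonal D)).PosDef := by
  refine .of_dotProduct_mulVec_pos (isHermitian_comp_diagonal fun i => (hD i).isHermitian)
    fun x hx => ?_
  obtain ⟨⟨i, a⟩, hia⟩ := Function.ne_iff.1 hx
  rw [star_trivial, dotProduct_comp_diagonal_mulVec]
  refine Finset.sum_pos' (fun i _ => (hD i).posSemidef.dotProduct_mulVec_nonneg _)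
    ⟨i, Finset.mem_univ i, (hD i).dotProduct_mulVec_pos ?_⟩
  exact Function.ne_iff.2 ⟨a, hia⟩

theorem toBlock_mulVec_of_support {n : Type*} [Fintype n] (p q : n → Prop) [DecidablePred q]
    (A : Matrix n n ℝ) {x : n → ℝ} (hx : ∀ z, ¬ q z → x z = 0) (z : {z // p z}) :
    (A.toBlock p q *ᵥ fun w => x w) z = (A *ᵥ x) z := by
  simp only [mulVec, dotProduct, toBlock_apply]
  rw [← Fintype.sum_subtype_add_sum_subtype q fun w => A z w * x w, left_eq_add]
  exact Finset.sum_eq_zero fun w _ => by rw [hx w w.2, mul_zero]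

end Matrix

/-! ### Structure of the network and existence of equilibria -/

namespace MSDNetwork

open Matrix

variable {V : Type*} [Fintype V] [DecidableEq V] {G : SimpleGraph V} [Fintype G.edgeSet] {r : ℕ}
  (N : MSDNetwork G r)

theorem bigM_posDef : N.bigM.PosDef := posDef_comp_diagonal N.inertia_posDef

theorem bigR_posSemidef : N.bigR.PosSemidef := posSemidef_comp_diagonal N.damping_posSemidef

theorem bigW_posDef : N.bigW.PosDef := posDef_comp_diagonal N.weight_posDef

theorem lap_posSemidef : N.lap.PosSemidef := by
  have := N.bigW_posDef.posSemidef.mul_mul_conjTranspose_same N.bigB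
  rwa [conjTranspose_eq_transpose_of_trivial] at this

theorem isUndamped_iff (i : V) : N.IsUndamped i ↔ ¬ N.IsDamped i := by
  rw [IsUndamped, IsDamped, (N.damping_posSemidef i).posDef_iff_det_ne_zero, not_not]

theorem head_ne_tail (k : G.edgeSet) : N.head k ≠ N.tail k := by
  intro h
  have h1 : G.Adj (N.tail k) (N.head k) := by
    rw [← SimpleGraph.mem_edgeSet, N.mk_tail_head]
    exact k.2
  exact h1.ne h.symm

theorem bigB_transpose_mulVec (x : V × Fin r → ℝ) (k : G.edgeSet) (a : Fin r) :
    (N.bigB.transpose *ᵥ x) (k, a) = x (N.head k, a) - x (N.tail k, a) := by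
  simp only [mulVec, dotProduct, Fintype.sum_prod_type, transpose_apply, bigB, kroneckerMap_apply,
    one_apply, mul_ite, mul_one, mul_zero, ite_mul, zero_mul, Finset.sum_ite_eq', Finset.mem_univ,
    if_true, incidence, of_apply]
  -- The nested conditional splits into a difference because an edge has distinct endpoints.
  have h : ∀ i, (if i = N.head k then x (i, a) else if i = N.tail k then -1 * x (i, a) else 0) =
      (if i = N.head k then x (i, a) else 0) - (if i = N.tail k then x (i, a) else 0) := by
    intro i
    by_cases h1 : i = N.head k
    · subst h1
      simp [N.head_ne_tail k]
    · by_cases h2 : i = N.tail k <;> simp [h1, h2, (N.head_ne_tail k).symm]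
  simp_all

/-- On a connected graph, the kernel of `𝔹ᵀ` consists of the vectors that agree at all nodes. -/
theorem eq_of_bigB_transpose_mulVec_eq_zero {x : V × Fin r → ℝ} (hx : N.bigB.transpose *ᵥ x = 0)
    (i j : V) (a : Fin r) : x (i, a) = x (j, a) := by
  obtain ⟨p⟩ := N.connected.preconnected i j
  induction p with
  | nil => rfl
  | @cons u v w h p ih =>
    rw [← ih]
    have h1 := congrFun hx (⟨s(u, v), h⟩, a)
    rw [bigB_transpose_mulVec, Pi.zero_apply, sub_eq_zero] at h1
    rcases Sym2.eq_iff.1 (N.mk_tail_head ⟨s(u, v), h⟩) with ⟨h2, h3⟩ | ⟨h2, h3⟩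
    · rw [h2, h3] at h1
      exact h1.symm
    · rw [h2, h3] at h1
      exact h1

theorem stackedId_mulVec (β : Fin r → ℝ) (z : V × Fin r) : (stackedId V r *ᵥ β) z = β z.2 := by
  simp [stackedId, mulVec, dotProduct]

theorem bigB_transpose_mulVec_stackedId (β : Fin r → ℝ) :
    N.bigB.transpose *ᵥ stackedId V r *ᵥ β = 0 := by
  ext ⟨k, a⟩
  rw [bigB_transpose_mulVec, stackedId_mulVec, stackedId_mulVec, sub_self, Pi.zero_apply]

theorem eq_zero_of_isDamped {x : V × Fin r → ℝ} (hx : N.bigR *ᵥ x = 0) {i : V} (hi : N.IsDamped i)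
    (a : Fin r) : x (i, a) = 0 := by
  have h : N.damping i *ᵥ (fun b => x (i, b)) = 0 := funext fun b => by
    have := congrFun hx (i, b)
    rwa [bigR, comp_diagonal_mulVec] at this
  exact congrFun (hi.eq_zero_of_mulVec_eq_zero h) a

/-- A vector in `ker 𝔹ᵀ` agrees at all nodes and `ker R` kills it at a damped one. This excludes
modes with eigenvalue zero. -/
theorem eq_zero_of_bigB_transpose_of_bigR (hd : ∃ i, N.IsDamped i) {x : V × Fin r → ℝ}
    (hB : N.bigB.transpose *ᵥ x = 0) (hR : N.bigR *ᵥ x = 0) : x = 0 := by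
  obtain ⟨i, hi⟩ := hd
  ext ⟨j, a⟩
  rw [N.eq_of_bigB_transpose_mulVec_eq_zero hB j i a]
  exact N.eq_zero_of_isDamped hR hi a

theorem lap_mulVec (x : V × Fin r → ℝ) :
    N.lap *ᵥ x = (N.bigB * N.bigW) *ᵥ N.bigB.transpose *ᵥ x := by
  rw [lap, mulVec_mulVec]

theorem bigB_transpose_mulVec_eq_zero_of_lap {x : V × Fin r → ℝ} (hx : x ⬝ᵥ N.lap *ᵥ x = 0) :
    N.bigB.transpose *ᵥ x = 0 := by
  apply N.bigW_posDef.eq_zero_of_mulVec_eq_zero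
  apply N.bigW_posDef.posSemidef.mulVec_eq_zero_of_dotProduct
  rwa [lap_mulVec, ← mulVec_mulVec, dotProduct_mulVec x N.bigB, ← mulVec_transpose] at hx

/-- For every constant input the closed-loop system has an equilibrium. -/
theorem exists_equilibrium (hd : ∃ i, N.IsDamped i) (v : V × Fin r → ℝ) :
    ∃ (β : Fin r → ℝ) (q : G.edgeSet × Fin r → ℝ),
      N.bigR *ᵥ stackedId V r *ᵥ β + (N.bigB * N.bigW) *ᵥ q = v := by
  set S := stackedId V r
  -- `T = R S Sᵀ R + L` takes values in `im (R S) + im (𝔹 W)`, so its surjectivity suffices. It is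
  -- positive semidefinite; if `T w = 0`, then `𝔹ᵀ w = 0` and `Sᵀ R w = 0`, so `w = S γ` and `w ⬝ R
  -- w = 0`.
  let T : (V × Fin r → ℝ) →ₗ[ℝ] (V × Fin r → ℝ) :=
    N.bigR.mulVecLin ∘ₗ S.mulVecLin ∘ₗ S.transpose.mulVecLin ∘ₗ N.bigR.mulVecLin +
      N.lap.mulVecLin
  have hT : ∀ w, T w = N.bigR *ᵥ S *ᵥ S.transpose *ᵥ N.bigR *ᵥ w + N.lap *ᵥ w := fun _ => rfl
  have hinj : Function.Injective T := by
    rw [← LinearMap.ker_eq_bot, LinearMap.ker_eq_bot']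
    intro w hw
    have h1 : w ⬝ᵥ N.bigR *ᵥ S *ᵥ S.transpose *ᵥ N.bigR *ᵥ w =
        (S.transpose *ᵥ N.bigR *ᵥ w) ⬝ᵥ (S.transpose *ᵥ N.bigR *ᵥ w) := by
      rw [N.bigR_posSemidef.isHermitian.dotProduct_mulVec_comm, dotProduct_comm,
        dotProduct_mulVec _ S, ← mulVec_transpose]
    have h2 := congrArg (w ⬝ᵥ ·) hw
    simp only [hT, dotProduct_add, dotProduct_zero] at h2
    rw [h1] at h2
    have h3 := N.lap_posSemidef.dotProduct_mulVec_nonneg w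
    rw [star_trivial] at h3
    have h4 : 0 ≤ (S.transpose *ᵥ N.bigR *ᵥ w) ⬝ᵥ (S.transpose *ᵥ N.bigR *ᵥ w) :=
      Finset.sum_nonneg fun _ _ => mul_self_nonneg _
    have hB : N.bigB.transpose *ᵥ w = 0 :=
      N.bigB_transpose_mulVec_eq_zero_of_lap (by linarith)
    have hS : S.transpose *ᵥ N.bigR *ᵥ w = 0 := dotProduct_self_eq_zero.1 (by linarith)
    obtain ⟨i, hi⟩ := hd
    have hwS : w = S *ᵥ fun a => w (i, a) := by
      ext ⟨j, a⟩
      rw [stackedId_mulVec]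
      exact N.eq_of_bigB_transpose_mulVec_eq_zero hB j i a
    refine N.eq_zero_of_bigB_transpose_of_bigR ⟨i, hi⟩ hB
      (N.bigR_posSemidef.mulVec_eq_zero_of_dotProduct ?_)
    have hRS : ∀ γ, N.bigR *ᵥ w ⬝ᵥ S *ᵥ γ = 0 := fun γ => by
      rw [dotProduct_mulVec, ← mulVec_transpose, hS, zero_dotProduct]
    have h5 := hRS fun a => w (i, a)
    rwa [← hwS, dotProduct_comm] at h5
  obtain ⟨w, hw⟩ := LinearMap.surjective_of_injective hinj v
  refine ⟨S.transpose *ᵥ N.bigR *ᵥ w, N.bigB.transpose *ᵥ w, ?_⟩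
  rw [← hw, hT, lap_mulVec]

/-! ### Consensus and undamped modes -/

/-- The pencil `(L, M)` has a real eigenvector in `ker R`. -/
def HasUndampedMode : Prop :=
  ∃ (μ : ℝ) (x : V × Fin r → ℝ), x ≠ 0 ∧ N.lap *ᵥ x = μ • N.bigM *ᵥ x ∧ N.bigR *ᵥ x = 0

theorem outputConsensus_of_not_hasUndampedMode (hd : ∃ i, N.IsDamped i) (v : V × Fin r → ℝ)
    (h : ¬ N.HasUndampedMode) : N.OutputConsensus v := by
  intro p q hpq
  obtain ⟨β, q₀, hβ⟩ := N.exists_equilibrium hd v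
  refine ⟨stackedId V r *ᵥ β, ⟨β, rfl⟩, ?_⟩
  have hM := N.bigM_posDef
  have hy : Tendsto (fun t => N.output p t - stackedId V r *ᵥ β) atTop (𝓝 0) := by
    refine hM.tendsto_zero_of_damped_oscillator N.bigB N.bigR_posSemidef N.bigW_posDef
      (fun μ x hx hR => ?_) (q := fun t => q t - q₀) (fun t ht => ?_) fun t ht => ?_
    · by_contra hne
      exact h ⟨μ, x, hne, hx, hR⟩
    · refine ((mulVec_hasDerivWithinAt N.bigM⁻¹ (hpq t ht).1).sub_const _).congr_deriv ?_
      rw [← hβ, output, ← mulVec_mulVec (M := N.bigR)]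
      simp only [mulVec_add, mulVec_sub, mulVec_neg]
      abel
    · refine ((hpq t ht).2.sub_const _).congr_deriv ?_
      rw [mulVec_sub, bigB_transpose_mulVec_stackedId, sub_zero, output, mulVec_mulVec]
  simpa using hy.add_const (stackedId V r *ᵥ β)

/-- Sampling at the times `(2πn + a) / ω` would make every value `cos a` equal to the limit. -/
theorem _root_.Real.not_tendsto_cos_mul_atTop {ω : ℝ} (hω : 0 < ω) (c : ℝ) :
    ¬ Tendsto (fun t => Real.cos (ω * t)) atTop (𝓝 c) := by
  intro h
  have ht : ∀ a : ℝ, Tendsto (fun n : ℕ => (n * (2 * Real.pi) + a) / ω) atTop atTop := fun a =>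
    ((tendsto_natCast_atTop_atTop.atTop_mul_const Real.two_pi_pos).atTop_add
      tendsto_const_nhds).atTop_div_const hω
  have hc : ∀ a : ℝ, Real.cos a = c := fun a => by
    refine tendsto_nhds_unique ?_ (h.comp (ht a))
    refine tendsto_const_nhds.congr fun n => ?_
    rw [Function.comp_apply, mul_div_cancel₀ _ hω.ne', add_comm, Real.cos_add_nat_mul_two_pi]
  have h1 := (hc 0).trans (hc Real.pi).symm
  norm_num at h1

theorem not_outputConsensus_of_hasUndampedMode (hd : ∃ i, N.IsDamped i) (v : V × Fin r → ℝ)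
    (h : N.HasUndampedMode) : ¬ N.OutputConsensus v := by
  obtain ⟨μ, x, hx, hL, hR⟩ := h
  obtain ⟨β, q₀, hβ⟩ := N.exists_equilibrium hd v
  intro hcons
  have hM := N.bigM_posDef
  have hB : N.bigB.transpose *ᵥ x ≠ 0 := fun hB =>
    hx (N.eq_zero_of_bigB_transpose_of_bigR hd hB hR)
  have hμ : 0 < μ := hM.pos_of_pencil_eigenvector N.bigB N.bigW_posDef hL hB
  set ω : ℝ := √μ
  have hω : 0 < ω := Real.sqrt_pos.2 hμ
  have hωμ : ω * ω = μ := Real.mul_self_sqrt hμ.le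
  set b : V × Fin r → ℝ := stackedId V r *ᵥ β with hb
  -- The mode oscillates with frequency `ω = √μ` around the equilibrium; it is undamped because `R x
  -- = 0`.
  let p : ℝ → V × Fin r → ℝ := fun t => N.bigM *ᵥ b + Real.cos (ω * t) • N.bigM *ᵥ x
  let q : ℝ → G.edgeSet × Fin r → ℝ :=
    fun t => q₀ + (Real.sin (ω * t) / ω) • N.bigB.transpose *ᵥ x
  have hout : ∀ t, N.bigM⁻¹ *ᵥ p t = b + Real.cos (ω * t) • x := fun t => by
    rw [mulVec_add, mulVec_smul, hM.inv_mulVec_mulVec, hM.inv_mulVec_mulVec]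
  have hlin : ∀ t : ℝ, HasDerivAt (fun t => ω * t) ω t := fun t => by
    simpa using (hasDerivAt_id t).const_mul ω
  have htraj : N.IsTrajectory v p q := by
    refine fun t _ => ⟨HasDerivAt.hasDerivWithinAt ?_, HasDerivAt.hasDerivWithinAt ?_⟩
    · refine (((hlin t).cos.smul_const (N.bigM *ᵥ x)).const_add (N.bigM *ᵥ b)).congr_deriv ?_
      have h1 : N.bigR *ᵥ (b + Real.cos (ω * t) • x) = N.bigR *ᵥ b := by
        rw [mulVec_add, mulVec_smul, hR, smul_zero, add_zero]
      have h2 : (N.bigB * N.bigW) *ᵥ q t =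
          (N.bigB * N.bigW) *ᵥ q₀ + (Real.sin (ω * t) * ω) • N.bigM *ᵥ x := by
        rw [mulVec_add, mulVec_smul, ← lap_mulVec, hL, smul_smul, ← hωμ]
        congr 2
        field_simp
      rw [← mulVec_mulVec, hout, h1, h2, ← hβ, neg_mul, neg_smul]
      abel
    · refine ((((hlin t).sin.div_const ω).smul_const
        (N.bigB.transpose *ᵥ x)).const_add q₀).congr_deriv ?_
      rw [← mulVec_mulVec, hout, mulVec_add, mulVec_smul, hb, bigB_transpose_mulVec_stackedId,
        zero_add, mul_div_cancel_right₀ _ hω.ne']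
  obtain ⟨y₀, -, hy₀⟩ := hcons p q htraj
  obtain ⟨z, hz⟩ := Function.ne_iff.1 hx
  refine Real.not_tendsto_cos_mul_atTop hω ((y₀ z - b z) / x z) ?_
  refine (((tendsto_pi_nhds.1 hy₀ z).sub_const (b z)).div_const (x z)).congr fun t => ?_
  rw [output, hout]
  simp only [Pi.add_apply, Pi.smul_apply, smul_eq_mul, add_sub_cancel_left]
  exact mul_div_cancel_right₀ _ hz

/-! ### Kron reduction -/

theorem Mu_posDef : N.Mu.PosDef := N.bigM_posDef.submatrix Subtype.val_injective

theorem lapKron_isHermitian : N.lapKron.IsHermitian := by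
  have hL := N.lap_posSemidef.isHermitian
  have hU : N.lapU.IsHermitian := hL.submatrix _
  have hD : N.lapD.IsHermitian := hL.submatrix _
  have h := isHermitian_conjTranspose_mul_mul N.lapI hD.inv
  rw [conjTranspose_eq_transpose_of_trivial] at h
  exact hU.sub h

/-- Undamped modes are supported at the undamped nodes, where they are the eigenvectors of the
Kron-reduced pencil in `ker L_i^i ∩ ker R_u`. -/
theorem hasUndampedMode_iff_lapKron :
    N.HasUndampedMode ↔ ∃ (μ : ℝ) (x : N.UndampedIdx → ℝ),
      x ≠ 0 ∧ N.lapKron *ᵥ x = μ • N.Mu *ᵥ x ∧ N.lapI *ᵥ x = 0 ∧ N.Ru *ᵥ x = 0 := by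
  have hKron : ∀ x : N.UndampedIdx → ℝ, N.lapI *ᵥ x = 0 → N.lapKron *ᵥ x = N.lapU *ᵥ x := by
    intro x hx
    rw [lapKron, sub_mulVec, ← mulVec_mulVec, hx, mulVec_zero, sub_zero]
  have hdiag : ∀ (D : V → Matrix (Fin r) (Fin r) ℝ) (x : V × Fin r → ℝ),
      (∀ z, ¬ N.IsUndamped z.1 → x z = 0) → ∀ z, ¬ N.IsUndamped z.1 →
      (Matrix.comp V V (Fin r) (Fin r) ℝ (diagonal D) *ᵥ x) z = 0 := by
    intro D x hx z hz
    rw [comp_diagonal_mulVec, show (fun b => x (z.1, b)) = 0 from funext fun b => hx _ hz,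
      mulVec_zero, Pi.zero_apply]
  constructor
  · rintro ⟨μ, x, hx0, hL, hR⟩
    have hx : ∀ z, ¬ N.IsUndamped z.1 → x z = 0 := fun z hz =>
      N.eq_zero_of_isDamped hR (not_not.1 (mt (N.isUndamped_iff z.1).2 hz)) z.2
    -- In the damped rows of `L x = μ M x` the right side vanishes, since `M` is block diagonal.
    have hI : N.lapI *ᵥ (fun z => x z) = 0 := funext fun z => by
      have hz : ¬ N.IsUndamped z.1.1 := fun h => (N.isUndamped_iff _).1 h z.2
      refine (toBlock_mulVec_of_support _ _ N.lap hx z).trans ?_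
      rw [hL, Pi.smul_apply, bigM, hdiag _ _ hx _ hz, smul_zero, Pi.zero_apply]
    refine ⟨μ, fun z => x z, fun h => hx0 (funext fun z => ?_), ?_, hI, funext fun z => ?_⟩
    · by_cases hz : N.IsUndamped z.1
      · exact congrFun h ⟨z, hz⟩
      · exact hx z hz
    · rw [hKron _ hI]
      ext z
      refine (toBlock_mulVec_of_support _ _ N.lap hx z).trans ?_
      rw [hL, Pi.smul_apply, Pi.smul_apply]
      exact congrArg (μ • ·) (toBlock_mulVec_of_support _ _ N.bigM hx z).symm
    · refine (toBlock_mulVec_of_support _ _ N.bigR hx z).trans ?_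
      rw [hR, Pi.zero_apply, Pi.zero_apply]
  · rintro ⟨μ, x, hx0, hL, hI, hR⟩
    rw [hKron _ hI] at hL
    -- Extension by zero to the damped nodes; `hI` supplies the damped rows of the full eigenvector
    -- equation.
    set e : V × Fin r → ℝ := fun z => if h : N.IsUndamped z.1 then x ⟨z, h⟩ else 0 with he
    have hsupp : ∀ z, ¬ N.IsUndamped z.1 → e z = 0 := fun z hz => dif_neg hz
    have hex : (fun z : N.UndampedIdx => e z) = x := funext fun z => dif_pos z.2
    rw [← hex] at hx0 hL hI hR
    refine ⟨μ, e, fun h => hx0 (funext fun z => congrFun h z), funext fun z => ?_,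
      funext fun z => ?_⟩
    · by_cases hz : N.IsUndamped z.1
      · have h1 := congrFun hL ⟨z, hz⟩
        refine (toBlock_mulVec_of_support _ _ N.lap hsupp ⟨z, hz⟩).symm.trans (h1.trans ?_)
        exact congrArg (μ • ·) (toBlock_mulVec_of_support _ _ N.bigM hsupp ⟨z, hz⟩)
      · have hz' : N.IsDamped z.1 := not_not.1 (mt (N.isUndamped_iff z.1).2 hz)
        refine (toBlock_mulVec_of_support _ _ N.lap hsupp
          (⟨z, hz'⟩ : {z : V × Fin r // N.IsDamped z.1})).symm.trans
          ((congrFun hI ⟨z, hz'⟩).trans ?_)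
        rw [Pi.smul_apply, bigM, hdiag _ _ hsupp _ hz, smul_zero, Pi.zero_apply]
    · by_cases hz : N.IsUndamped z.1
      · exact (toBlock_mulVec_of_support _ _ N.bigR hsupp ⟨z, hz⟩).symm.trans
          (congrFun hR ⟨z, hz⟩)
      · exact hdiag _ _ hsupp _ hz

end MSDNetwork

/-! ### The equivalence -/

theorem theorem1 {V : Type*} [Fintype V] [DecidableEq V] {G : SimpleGraph V} [Fintype G.edgeSet]
    {r : ℕ} (N : MSDNetwork G r)
    (hd : ∃ i, N.IsDamped i) (hu : ∃ i, N.IsUndamped i)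
    (v : V × Fin r → ℝ) (𝕜 : Type*) [RCLike 𝕜] :
    List.TFAE [
      N.OutputConsensus v,
      ∀ (μ : 𝕜) (x : N.UndampedIdx → 𝕜),
        Matrix.HasEigenvectorOver 𝕜 (N.Mu⁻¹ * N.lapKron) μ x →
        ¬ ((N.lapI.map (algebraMap ℝ 𝕜)).mulVec x = 0 ∧
          (N.Ru.map (algebraMap ℝ 𝕜)).mulVec x = 0),
      ∀ (μ : 𝕜) (x : V × Fin r → 𝕜),
        Matrix.HasEigenvectorOver 𝕜 (N.bigM⁻¹ * N.lap) μ x →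
        ¬ ((N.bigR.map (algebraMap ℝ 𝕜)).mulVec x = 0 ∧
          ∀ i, N.IsDamped i → ∀ a, x (i, a) = 0)] := by
  have h₁ : N.OutputConsensus v ↔ ¬ N.HasUndampedMode :=
    ⟨fun h hN => N.not_outputConsensus_of_hasUndampedMode hd v hN h,
      N.outputConsensus_of_not_hasUndampedMode hd v⟩
  tfae_have 1 ↔ 2 := by
    rw [h₁, N.hasUndampedMode_iff_lapKron]
    constructor
    · rintro h μ x hx ⟨hI, hR⟩
      obtain ⟨ν, z, hz, hL, hK⟩ := N.Mu_posDef.exists_real_eigenvector N.lapKron_isHermitian hx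
      exact h ⟨ν, z, hz, hL, hK _ hI, hK _ hR⟩
    · rintro h ⟨ν, z, hz, hL, hI, hR⟩
      refine h _ _ (N.Mu_posDef.hasEigenvectorOver_ofReal hz hL) ⟨?_, ?_⟩
      · rw [Matrix.map_mulVec_ofReal, hI]
        ext
        simp
      · rw [Matrix.map_mulVec_ofReal, hR]
        ext
        simp
  tfae_have 1 ↔ 3 := by
    rw [h₁]
    constructor
    -- Vanishing at damped nodes is automatic on `ker R`, so that conjunct carries no information.
    · rintro h μ x hx ⟨hR, -⟩
      obtain ⟨ν, z, hz, hL, hK⟩ :=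
        N.bigM_posDef.exists_real_eigenvector N.lap_posSemidef.isHermitian hx
      exact h ⟨ν, z, hz, hL, hK _ hR⟩
    · rintro h ⟨ν, z, hz, hL, hR⟩
      refine h _ _ (N.bigM_posDef.hasEigenvectorOver_ofReal hz hL) ⟨?_, fun i hi a => ?_⟩
      · rw [Matrix.map_mulVec_ofReal, hR]
        ext
        simp
      · rw [N.eq_zero_of_isDamped hR hi a, map_zero]
  tfae_finish
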